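/- Let $G$ be a finite group acting linearly on $\mathbb{C}^n$. For $r\in\mathbb{N}$ let $\mathcal{O}^r_G$ be the space of $r$-jets at the origin of $G$-invariant analytic germs $(\mathbb{C}^n,0)\to(\mathbb{C},0)$ with a critical point at the origin, with the topology induced from the finite-dimensional space of all $r$-jets, and let $D^r_G$ be the group of $r$-jets of $G$-equivariant analytic diffeomorphism germs $(\mathbb{C}^n,0)\to(\mathbb{C}^n,0)$, which acts on $\mathcal{O}^r_G$ by $j^r(\varphi)\cdot j^r(f)=j^r(f\circ\varphi^{-1})$. Call a $G$-invariant analytic germ $f:(\mathbb{C}^n,0)\to(\mathbb{C},0)$ with a critical point at the origin *equivariantly simple* if there is an $N\in\mathbb{N}$ such that for all sufficiently large $r$ the jet $j^r(f)$ has a neighbourhood in $\mathcal{O}^r_G$ that meets at most $N$ orbits of $D^r_G$, and *equivariantly stable* if for all sufficiently large $r$ the $D^r_G$-orbit of $j^r(f)$ is open in $\mathcal{O}^r_G$. **Theorem 3.2.** For the given action of $G$ on $\mathbb{C}^n$, an equivariantly simple germ exists if and only if an equivariantly stable germ exists. -/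

import Mathlib

open Filter Topology

noncomputable section

namespace EquivSing

/-- The space of `r`-jets at the origin of maps from `ℂⁿ` to `F`: a jet is recorded by the
derivatives of order `0, …, r` at the origin, i.e. by the Taylor polynomial of degree `r`.
It carries the product topology. -/
abbrev Jet (n r : ℕ) (F : Type) [NormedAddCommGroup F] [NormedSpace ℂ F] : Type :=
  ∀ k : Fin (r + 1), ContinuousMultilinearMap ℂ (fun _ : Fin (k : ℕ) => Fin n → ℂ) F

/-- The `r`-jet at the origin of a map. -/
def jet {n : ℕ} (r : ℕ) {F : Type} [NormedAddCommGroup F] [NormedSpace ℂ F]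
    (f : (Fin n → ℂ) → F) : Jet n r F :=
  fun k => iteratedFDeriv ℂ (k : ℕ) f 0

section JetLemmas

variable {n r : ℕ} {F : Type} [NormedAddCommGroup F] [NormedSpace ℂ F]

/-- The jet depends only on the germ. -/
theorem jet_congr {f g : (Fin n → ℂ) → F} (h : f =ᶠ[𝓝 0] g) : jet r f = jet r g := by
  funext k
  exact (h.iteratedFDeriv ℂ (k : ℕ)).eq_of_nhds

/-- The jet of a composition depends only on the jets of the two maps. -/
theorem jet_comp_congr [CompleteSpace F] {f f' : (Fin n → ℂ) → F} {φ φ' : (Fin n → ℂ) → (Fin n → ℂ)}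
    (hf : AnalyticAt ℂ f 0) (hf' : AnalyticAt ℂ f' 0)
    (hφ : AnalyticAt ℂ φ 0) (hφ' : AnalyticAt ℂ φ' 0)
    (h0 : φ 0 = 0) (h0' : φ' 0 = 0)
    (hff : jet r f = jet r f') (hφφ : jet r φ = jet r φ') :
    jet r (f ∘ φ) = jet r (f' ∘ φ') := by
  funext k
  have hk : (k : ℕ) < r + 1 := k.2
  have e1 : ∀ m : ℕ, m < r + 1 → iteratedFDeriv ℂ m f 0 = iteratedFDeriv ℂ m f' 0 :=
    fun m hm => congrFun hff ⟨m, hm⟩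
  have e2 : ∀ m : ℕ, m < r + 1 → iteratedFDeriv ℂ m φ 0 = iteratedFDeriv ℂ m φ' 0 :=
    fun m hm => congrFun hφφ ⟨m, hm⟩
  have c1 : ContDiffAt ℂ (k : ℕ) f (φ 0) := by rw [h0]; exact hf.contDiffAt
  have c2 : ContDiffAt ℂ (k : ℕ) f' (φ' 0) := by rw [h0']; exact hf'.contDiffAt
  change iteratedFDeriv ℂ (k : ℕ) (f ∘ φ) 0 = iteratedFDeriv ℂ (k : ℕ) (f' ∘ φ') 0
  rw [iteratedFDeriv_comp c1 hφ.contDiffAt le_rfl, iteratedFDeriv_comp c2 hφ'.contDiffAt le_rfl,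
    h0, h0']
  refine Finset.sum_congr rfl fun c _ => ?_
  ext v
  have hp : (fun m : Fin c.length => ftaylorSeries ℂ φ 0 (c.partSize m))
      = fun m : Fin c.length => ftaylorSeries ℂ φ' 0 (c.partSize m) := by
    funext m
    exact e2 _ (lt_of_le_of_lt (c.partSize_le m) hk)
  have hq : ftaylorSeries ℂ f 0 c.length = ftaylorSeries ℂ f' 0 c.length :=
    e1 _ (lt_of_le_of_lt c.length_le hk)
  change c.compAlongOrderedFinpartition (ftaylorSeries ℂ f 0 c.length)
      (fun m => ftaylorSeries ℂ φ 0 (c.partSize m)) v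
    = c.compAlongOrderedFinpartition (ftaylorSeries ℂ f' 0 c.length)
      (fun m => ftaylorSeries ℂ φ' 0 (c.partSize m)) v
  rw [hp, hq]

end JetLemmas

variable {G : Type*} [Group G] {n : ℕ}

/-- (A representative of) a `G`-invariant analytic function germ `(ℂⁿ, 0) → (ℂ, 0)` with a
critical point at the origin. -/
structure CritInvGerm (ρ : Representation ℂ G (Fin n → ℂ)) where
  toFun : (Fin n → ℂ) → ℂ
  analytic : AnalyticAt ℂ toFun 0
  map_zero : toFun 0 = 0
  critical : fderiv ℂ toFun 0 = 0
  invariant : ∀ g : G, ∀ᶠ x in 𝓝 0, toFun (ρ g x) = toFun x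

/-- (A representative of) the germ of a `G`-equivariant analytic diffeomorphism
`(ℂⁿ, 0) → (ℂⁿ, 0)`, together with a representative of the inverse germ. -/
structure EquivDiffeo (ρ : Representation ℂ G (Fin n → ℂ)) where
  toFun : (Fin n → ℂ) → (Fin n → ℂ)
  invFun : (Fin n → ℂ) → (Fin n → ℂ)
  analytic : AnalyticAt ℂ toFun 0
  analytic_inv : AnalyticAt ℂ invFun 0
  map_zero : toFun 0 = 0
  inv_zero : invFun 0 = 0
  left_inv : ∀ᶠ x in 𝓝 0, invFun (toFun x) = x
  right_inv : ∀ᶠ x in 𝓝 0, toFun (invFun x) = x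
  equivariant : ∀ g : G, ∀ᶠ x in 𝓝 0, toFun (ρ g x) = ρ g (toFun x)

section Germs

variable {ρ : Representation ℂ G (Fin n → ℂ)}

theorem tendsto_rep (ρ : Representation ℂ G (Fin n → ℂ)) (g : G) :
    Tendsto (fun x => ρ g x) (𝓝 0) (𝓝 0) := by
  have h : Continuous (ρ g) := LinearMap.continuous_of_finiteDimensional (ρ g)
  simpa using h.tendsto 0

namespace EquivDiffeo

theorem tendsto (φ : EquivDiffeo ρ) : Tendsto φ.toFun (𝓝 0) (𝓝 0) := by
  simpa [φ.map_zero] using φ.analytic.continuousAt.tendsto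

theorem tendsto_inv (φ : EquivDiffeo ρ) : Tendsto φ.invFun (𝓝 0) (𝓝 0) := by
  simpa [φ.inv_zero] using φ.analytic_inv.continuousAt.tendsto

theorem equivariant_inv (φ : EquivDiffeo ρ) (g : G) :
    ∀ᶠ x in 𝓝 0, φ.invFun (ρ g x) = ρ g (φ.invFun x) := by
  filter_upwards [φ.right_inv, φ.tendsto_inv.eventually (φ.equivariant g),
    ((tendsto_rep ρ g).comp φ.tendsto_inv).eventually φ.left_inv] with x h1 h2 h3
  simp only [Function.comp] at h3
  rw [h2, h1] at h3
  exact h3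

/-- The identity. -/
def refl (ρ : Representation ℂ G (Fin n → ℂ)) : EquivDiffeo ρ where
  toFun := id
  invFun := id
  analytic := analyticAt_id
  analytic_inv := analyticAt_id
  map_zero := rfl
  inv_zero := rfl
  left_inv := Eventually.of_forall fun _ => rfl
  right_inv := Eventually.of_forall fun _ => rfl
  equivariant := fun _ => Eventually.of_forall fun _ => rfl

/-- The inverse germ. -/
def symm (φ : EquivDiffeo ρ) : EquivDiffeo ρ where
  toFun := φ.invFun
  invFun := φ.toFun
  analytic := φ.analytic_inv
  analytic_inv := φ.analytic
  map_zero := φ.inv_zero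
  inv_zero := φ.map_zero
  left_inv := φ.right_inv
  right_inv := φ.left_inv
  equivariant := φ.equivariant_inv

/-- The composition `φ ∘ ψ`. -/
def comp (φ ψ : EquivDiffeo ρ) : EquivDiffeo ρ where
  toFun := φ.toFun ∘ ψ.toFun
  invFun := ψ.invFun ∘ φ.invFun
  analytic := φ.analytic.comp_of_eq ψ.analytic ψ.map_zero
  analytic_inv := ψ.analytic_inv.comp_of_eq φ.analytic_inv φ.inv_zero
  map_zero := by simp [ψ.map_zero, φ.map_zero]
  inv_zero := by simp [ψ.inv_zero, φ.inv_zero]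
  left_inv := by
    filter_upwards [ψ.left_inv, ψ.tendsto.eventually φ.left_inv] with x h1 h2
    simp [h1, h2]
  right_inv := by
    filter_upwards [φ.right_inv, φ.tendsto_inv.eventually ψ.right_inv] with x h1 h2
    simp [h1, h2]
  equivariant := fun g => by
    filter_upwards [ψ.equivariant g, ψ.tendsto.eventually (φ.equivariant g)] with x h1 h2
    simp [h1, h2]

end EquivDiffeo

/-- The germ `f ∘ φ⁻¹`. -/
def CritInvGerm.push (f : CritInvGerm ρ) (φ : EquivDiffeo ρ) : CritInvGerm ρ where
  toFun := f.toFun ∘ φ.invFun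
  analytic := f.analytic.comp_of_eq φ.analytic_inv φ.inv_zero
  map_zero := by simp [φ.inv_zero, f.map_zero]
  critical := by
    have h1 : DifferentiableAt ℂ f.toFun (φ.invFun 0) := by
      rw [φ.inv_zero]; exact f.analytic.differentiableAt
    rw [fderiv_comp _ h1 φ.analytic_inv.differentiableAt, φ.inv_zero, f.critical]
    simp
  invariant := fun g => by
    filter_upwards [φ.equivariant_inv g, φ.tendsto_inv.eventually (f.invariant g)] with x h1 h2
    simp [h1, h2]

end Germs

/-- Equality of `r`-jets of equivariant diffeomorphism germs. -/
def jetSetoid (ρ : Representation ℂ G (Fin n → ℂ)) (r : ℕ) : Setoid (EquivDiffeo ρ) where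
  r φ ψ := jet r φ.toFun = jet r ψ.toFun
  iseqv := ⟨fun _ => rfl, fun h => h.symm, fun h h' => h.trans h'⟩

/-- `D^r_G`: the `r`-jets of `G`-equivariant diffeomorphism germs `(ℂⁿ, 0) → (ℂⁿ, 0)`. -/
def DiffeoJets (ρ : Representation ℂ G (Fin n → ℂ)) (r : ℕ) : Type :=
  Quotient (jetSetoid ρ r)

/-- `O^r_G`: the `r`-jets of `G`-invariant germs `(ℂⁿ, 0) → (ℂ, 0)` with a critical point at the
origin, with the topology induced from the finite-dimensional space of all `r`-jets. -/
abbrev FunJets (ρ : Representation ℂ G (Fin n → ℂ)) (r : ℕ) : Type :=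
  {j : Jet n r ℂ // ∃ f : CritInvGerm ρ, jet r f.toFun = j}

/-- The `r`-jet of an invariant germ with a critical point, as a point of `O^r_G`. -/
def CritInvGerm.jet {ρ : Representation ℂ G (Fin n → ℂ)} (f : CritInvGerm ρ) (r : ℕ) :
    FunJets ρ r :=
  ⟨EquivSing.jet r f.toFun, f, rfl⟩

/-- The `r`-jet of an equivariant diffeomorphism germ, as an element of `D^r_G`. -/
def EquivDiffeo.jet {ρ : Representation ℂ G (Fin n → ℂ)} (φ : EquivDiffeo ρ) (r : ℕ) :
    DiffeoJets ρ r :=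
  Quotient.mk (jetSetoid ρ r) φ

section Action

variable {ρ : Representation ℂ G (Fin n → ℂ)} {r : ℕ}

theorem jet_comp_eq {φ φ' ψ ψ' : EquivDiffeo ρ} (h : jet r φ.toFun = jet r φ'.toFun)
    (h' : jet r ψ.toFun = jet r ψ'.toFun) :
    jet r (φ.comp ψ).toFun = jet r (φ'.comp ψ').toFun :=
  jet_comp_congr (f := φ.toFun) (f' := φ'.toFun) (φ := ψ.toFun) (φ' := ψ'.toFun)
    φ.analytic φ'.analytic ψ.analytic ψ'.analytic ψ.map_zero ψ'.map_zero h h'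

theorem jet_symm_eq {φ φ' : EquivDiffeo ρ} (h : jet r φ.toFun = jet r φ'.toFun) :
    jet r φ.symm.toFun = jet r φ'.symm.toFun := by
  have h1 : jet r φ.symm.toFun = jet r (φ.symm.comp (φ'.comp φ'.symm)).toFun := by
    refine jet_congr ?_
    filter_upwards [φ'.right_inv] with x hx
    simp [EquivDiffeo.comp, EquivDiffeo.symm, hx]
  have h2 : jet r (φ.symm.comp (φ.comp φ'.symm)).toFun = jet r φ'.symm.toFun := by
    refine jet_congr ?_
    filter_upwards [φ'.tendsto_inv.eventually φ.left_inv] with x hx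
    simp [EquivDiffeo.comp, EquivDiffeo.symm, hx]
  rw [h1, ← h2]
  exact jet_comp_eq rfl (jet_comp_eq h.symm rfl)

theorem jet_push_eq {f f' : CritInvGerm ρ} {φ φ' : EquivDiffeo ρ}
    (h : jet r f.toFun = jet r f'.toFun) (h' : jet r φ.toFun = jet r φ'.toFun) :
    jet r (f.push φ).toFun = jet r (f'.push φ').toFun :=
  jet_comp_congr (f := f.toFun) (f' := f'.toFun) (φ := φ.invFun) (φ' := φ'.invFun)
    f.analytic f'.analytic φ.analytic_inv φ'.analytic_inv φ.inv_zero φ'.inv_zero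
    h (jet_symm_eq h')

/-- `D^r_G` is a group under composition. -/
instance : Group (DiffeoJets ρ r) where
  mul := Quotient.map₂ EquivDiffeo.comp fun _ _ h _ _ h' => jet_comp_eq h h'
  one := (EquivDiffeo.refl ρ).jet r
  inv := Quotient.map EquivDiffeo.symm fun _ _ h => jet_symm_eq h
  mul_assoc := by
    rintro ⟨a⟩ ⟨b⟩ ⟨c⟩
    rfl
  one_mul := by
    rintro ⟨a⟩
    rfl
  mul_one := by
    rintro ⟨a⟩
    rfl
  inv_mul_cancel := by
    rintro ⟨a⟩
    exact Quotient.sound (s := jetSetoid ρ r) (jet_congr a.left_inv)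

/-- `D^r_G` acts on `O^r_G` by changes of coordinates: `j^r(φ) • j^r(f) = j^r(f ∘ φ⁻¹)`,
see `smul_jet`. -/
instance : SMul (DiffeoJets ρ r) (FunJets ρ r) where
  smul a j := Quotient.lift (fun φ : EquivDiffeo ρ => (j.2.choose.push φ).jet r)
    (fun _ _ h => Subtype.ext (jet_push_eq rfl h)) a

theorem smul_jet (φ : EquivDiffeo ρ) (f : CritInvGerm ρ) :
    φ.jet r • f.jet r = (f.push φ).jet r :=
  Subtype.ext (jet_push_eq (f.jet r).2.choose_spec rfl)

instance : MulAction (DiffeoJets ρ r) (FunJets ρ r) where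
  one_smul := by
    rintro ⟨_, f, rfl⟩
    exact smul_jet (EquivDiffeo.refl ρ) f
  mul_smul := by
    rintro ⟨a⟩ ⟨b⟩ ⟨_, f, rfl⟩
    change (a.comp b).jet r • f.jet r = a.jet r • b.jet r • f.jet r
    rw [smul_jet, smul_jet, smul_jet]
    rfl

end Action

/-- `f` is equivariantly simple: there is an `N` such that for all sufficiently large `r` the
`r`-jet of `f` has a neighbourhood in `O^r_G` that meets at most `N` orbits of `D^r_G`. -/
def EquivariantlySimple {ρ : Representation ℂ G (Fin n → ℂ)} (f : CritInvGerm ρ) : Prop :=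
  ∃ N : ℕ, ∀ᶠ r : ℕ in atTop, ∃ U ∈ 𝓝 (f.jet r),
    {S : Set (FunJets ρ r) |
      (∃ j, S = MulAction.orbit (DiffeoJets ρ r) j) ∧ (S ∩ U).Nonempty}.encard ≤ N

/-- `f` is equivariantly stable: for all sufficiently large `r` the `D^r_G`-orbit of the `r`-jet
of `f` is open in `O^r_G`. -/
def EquivariantlyStable {ρ : Representation ℂ G (Fin n → ℂ)} (f : CritInvGerm ρ) : Prop :=
  ∀ᶠ r : ℕ in atTop, IsOpen (MulAction.orbit (DiffeoJets ρ r) (f.jet r))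

end EquivSing

end

/-! If the orbit of a germ is open, that orbit is a neighbourhood meeting a single orbit, so a
stable germ is simple. The content is the converse. A simple germ need not itself be stable (for
trivial `G` on `ℂ`, consider `x ^ 3`), so another germ has to be found.

Fix `r ≥ 1`. The space `O^r_G` is a finite-dimensional vector space, and by Faà di Bruno's formula
the jet of `f ∘ φ` is linear in the jet of `f` and polynomial in the jet of `φ`. Hence each orbit is
the image of the complement of a hypersurface under a polynomial map `F z`, linear in the base point
`z` (`exists_coordinates`). If finitely many orbits cover a nonempty open set, some `F z₀` has
algebraically independent components; otherwise a product of annihilating polynomials would vanish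
on that set. By the Jacobian criterion `F z₀` is then a submersion at a generic parameter, and so is
`F z` for all `z` off a hypersurface (`exists_generic_open`). An orbit with an interior point is
open by homogeneity, so the generic orbit is open (`exists_generic_isOpen_orbit`).

This gives, for each large `r`, a nonzero polynomial condition on `r`-jets. A single germ must
satisfy all of them: on a Banach space of invariant power series each condition is open and dense,
and Baire's theorem supplies the germ (`exists_generic_germ`). -/

noncomputable section

namespace EquivSing

/-! ### The Jacobian criterion via Kähler differentials -/

/-- A field extension of finite type of a domain `A` of characteristic zero is formally smooth
over `A`, hence the differentials of `A` inject into those of the field. -/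
theorem mapBaseChange_injective (k A K : Type) [Field k] [CharZero k] [CommRing A] [IsDomain A]
    [Field K] [Algebra k A] [Algebra k K] [Algebra A K] [IsScalarTower k A K] [FaithfulSMul A K]
    [Algebra.EssFiniteType k K] :
    Function.Injective (KaehlerDifferential.mapBaseChange k A K) := by
  let L := FractionRing A
  let _ : Algebra L K := FractionRing.liftAlgebra A K
  have : IsScalarTower A L K := inferInstance
  have : IsScalarTower k L K := IsScalarTower.to₁₃₄ k A L K
  have : CharZero L := charZero_of_injective_algebraMap (algebraMap k L).injective
  have : Algebra.EssFiniteType L K := Algebra.EssFiniteType.of_comp k L K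
  have : Algebra.FormallySmooth L K := inferInstance
  have : Algebra.FormallySmooth A L := .of_isLocalization (nonZeroDivisors A)
  have : Algebra.FormallySmooth A K := .comp A L K
  -- The kernel of `K ⊗ Ω_A → Ω_K` is the image of the first cotangent homology of `K` over `A`,
  -- which vanishes by formal smoothness.
  have := Algebra.FormallySmooth.subsingleton_h1Cotangent (R := A) (A := K)
  rw [injective_iff_map_eq_zero]
  intro x hx
  obtain ⟨y, rfl⟩ := (Algebra.H1Cotangent.exact_δ_mapBaseChange k A K x).mp hx
  rw [Subsingleton.elim y 0, map_zero]

/-- In characteristic zero the differentials of algebraically independent elements are linearly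
independent. -/
theorem linearIndependent_D {k K : Type} [Field k] [CharZero k] [Field K] [Algebra k K]
    [Algebra.EssFiniteType k K] {ι : Type} {a : ι → K} (ha : AlgebraicIndependent k a) :
    LinearIndependent K (fun i => KaehlerDifferential.D k K (a i)) := by
  let _ : Algebra (MvPolynomial ι k) K := (MvPolynomial.aeval a).toRingHom.toAlgebra
  have : IsScalarTower k (MvPolynomial ι k) K :=
    IsScalarTower.of_algebraMap_eq fun x => ((MvPolynomial.aeval a).commutes x).symm
  have : FaithfulSMul (MvPolynomial ι k) K := (faithfulSMul_iff_algebraMap_injective _ K).2 ha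
  have h1 := ((KaehlerDifferential.mvPolynomialBasis k ι).baseChange K).linearIndependent
  have h2 := h1.map' (KaehlerDifferential.mapBaseChange k (MvPolynomial ι k) K)
    (LinearMap.ker_eq_bot.2 (mapBaseChange_injective k (MvPolynomial ι k) K))
  convert! h2 using 1
  funext i
  have h3 : algebraMap (MvPolynomial ι k) K (MvPolynomial.X i) = a i :=
    MvPolynomial.aeval_X a i
  simp [← h3]

open MvPolynomial in
/-- The Jacobian criterion in characteristic zero: the gradients of algebraically independent
polynomials are linearly independent over the field of rational functions. -/
theorem linearIndependent_pderiv {m w : ℕ} {F : Fin w → MvPolynomial (Fin m) ℂ}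
    (hF : AlgebraicIndependent ℂ F) (K : Type) [Field K] [Algebra (MvPolynomial (Fin m) ℂ) K]
    [IsFractionRing (MvPolynomial (Fin m) ℂ) K] [Algebra ℂ K]
    [IsScalarTower ℂ (MvPolynomial (Fin m) ℂ) K] :
    LinearIndependent K
      (fun i j => algebraMap (MvPolynomial (Fin m) ℂ) K (pderiv j (F i))) := by
  have : Algebra.EssFiniteType (MvPolynomial (Fin m) ℂ) K :=
    .of_isLocalization K (nonZeroDivisors (MvPolynomial (Fin m) ℂ))
  have : Algebra.EssFiniteType ℂ K := .comp ℂ (MvPolynomial (Fin m) ℂ) K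
  have hli := linearIndependent_D
    (hF.map' (f := IsScalarTower.toAlgHom ℂ (MvPolynomial (Fin m) ℂ) K)
      (IsFractionRing.injective (MvPolynomial (Fin m) ℂ) K))
  -- The chain rule `dp = ∑ ∂ⱼp dXⱼ` turns a relation between gradients into a relation between the
  -- differentials of the `F i`.
  have hD : ∀ p : MvPolynomial (Fin m) ℂ, KaehlerDifferential.D ℂ K (algebraMap _ K p)
      = ∑ j, algebraMap _ K (pderiv j p) •
        KaehlerDifferential.D ℂ K (algebraMap (MvPolynomial (Fin m) ℂ) K (X j)) := by
    intro p
    have h1 : KaehlerDifferential.D ℂ (MvPolynomial (Fin m) ℂ) p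
        = ∑ j, pderiv j p • KaehlerDifferential.D ℂ (MvPolynomial (Fin m) ℂ) (X j) := by
      conv_lhs => rw [← (KaehlerDifferential.mvPolynomialBasis ℂ (Fin m)).sum_repr
        (KaehlerDifferential.D ℂ (MvPolynomial (Fin m) ℂ) p)]
      simp
    have h2 := congrArg (KaehlerDifferential.map ℂ ℂ (MvPolynomial (Fin m) ℂ) K) h1
    simpa [map_sum] using h2
  rw [Fintype.linearIndependent_iff] at hli ⊢
  intro g hg
  refine hli g ?_
  have hDF := fun i => hD (F i)
  simp only [Function.comp_apply, IsScalarTower.coe_toAlgHom']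
  simp_rw [hDF, Finset.smul_sum, smul_smul]
  rw [Finset.sum_comm]
  simp_rw [← Finset.sum_smul]
  refine Finset.sum_eq_zero fun j _ => ?_
  have h := congrFun hg j
  simp only [Finset.sum_apply, Pi.smul_apply, smul_eq_mul, Pi.zero_apply] at h
  rw [h, zero_smul]

open MvPolynomial in
/-- A common denominator clears a right inverse of the Jacobian matrix. -/
theorem exists_jacobian_mul_eq {m w : ℕ} {F : Fin w → MvPolynomial (Fin m) ℂ}
    (hF : AlgebraicIndependent ℂ F) :
    ∃ (R : Matrix (Fin m) (Fin w) (MvPolynomial (Fin m) ℂ)) (d : MvPolynomial (Fin m) ℂ),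
      d ≠ 0 ∧ Matrix.of (fun i j => pderiv j (F i)) * R = Matrix.scalar (Fin w) d := by
  let J : Matrix (Fin w) (Fin m) (FractionRing (MvPolynomial (Fin m) ℂ)) :=
    Matrix.of fun i j => algebraMap _ _ (pderiv j (F i))
  have h1 : LinearIndependent _ J.row := linearIndependent_pderiv hF _
  obtain ⟨R, hR⟩ : ∃ R : Matrix (Fin m) (Fin w) (FractionRing (MvPolynomial (Fin m) ℂ)),
      J * R = 1 := by
    rw [← Matrix.mulVec_surjective_iff_exists_right_inverse]
    have h2 : J.rank = w := by simpa using h1.rank_matrix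
    have h3 : J.mulVecLin.range = ⊤ := Submodule.eq_top_of_finrank_eq (by
      rw [Module.finrank_fin_fun]; exact h2)
    exact LinearMap.range_eq_top.1 h3
  obtain ⟨d, hd⟩ := IsLocalization.exist_integer_multiples_of_finite
    (nonZeroDivisors (MvPolynomial (Fin m) ℂ)) (fun p : Fin m × Fin w => R p.1 p.2)
  choose R' hR' using hd
  refine ⟨Matrix.of fun i j => R' (i, j), d, nonZeroDivisors.ne_zero d.2, ?_⟩
  apply Matrix.map_injective
    (IsFractionRing.injective (MvPolynomial (Fin m) ℂ) (FractionRing (MvPolynomial (Fin m) ℂ)))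
  ext i k
  have h2 := congrFun (congrFun hR i) k
  simp only [Matrix.mul_apply, J, Matrix.of_apply] at h2
  simp only [Matrix.map_apply, Matrix.mul_apply, Matrix.of_apply, map_sum, map_mul, hR',
    Algebra.smul_def, mul_left_comm, ← Finset.mul_sum, h2]
  by_cases hik : i = k
  · subst hik; simp
  · simp [hik]

/-! ### Openness of polynomial maps at generic parameters -/

/-- The derivative of a polynomial function. -/
theorem hasStrictFDerivAt_eval {m : ℕ} (p : MvPolynomial (Fin m) ℂ) (t : Fin m → ℂ) :
    HasStrictFDerivAt (fun t => MvPolynomial.eval t p)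
      (∑ j, MvPolynomial.eval t (MvPolynomial.pderiv j p) •
        (ContinuousLinearMap.proj j : (Fin m → ℂ) →L[ℂ] ℂ)) t := by
  induction p using MvPolynomial.induction_on with
  | C a =>
    refine (hasStrictFDerivAt_const (𝕜 := ℂ) a t).congr_fderiv ?_ |>.congr_of_eventuallyEq
      (Eventually.of_forall fun t => by simp)
    ext v
    simp
  | add p q hp hq =>
    refine ((hp.add hq).congr_fderiv ?_).congr_of_eventuallyEq
      (Eventually.of_forall fun t => by simp)
    ext v
    simp [add_mul, Finset.sum_add_distrib]
  | mul_X p i hp =>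
    have h := hp.mul ((ContinuousLinearMap.proj i : (Fin m → ℂ) →L[ℂ] ℂ).hasStrictFDerivAt (x := t))
    refine (h.congr_fderiv ?_).congr_of_eventuallyEq (Eventually.of_forall fun t => by simp)
    ext v
    simp [apply_ite, Derivation.leibniz, MvPolynomial.pderiv_X, Pi.single_apply, add_mul,
      Finset.sum_add_distrib, Finset.mul_sum, mul_assoc]

open MvPolynomial in
/-- A polynomial map whose Jacobian matrix at `t` has a right inverse is open at `t`. -/
theorem map_nhds_eval_eq {m w : ℕ} (F : Fin w → MvPolynomial (Fin m) ℂ) (t : Fin m → ℂ)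
    (R : Matrix (Fin m) (Fin w) ℂ)
    (hR : IsUnit (Matrix.of (fun i j => eval t (pderiv j (F i))) * R).det) :
    map (fun t i => eval t (F i)) (𝓝 t) = 𝓝 (fun i => eval t (F i)) := by
  have h := hasStrictFDerivAt_pi.2 fun i => hasStrictFDerivAt_eval (F i) t
  refine h.map_nhds_eq_of_surj ?_
  rw [LinearMap.range_eq_top]
  intro y
  set J := Matrix.of (fun i j => eval t (pderiv j (F i)))
  refine ⟨R.mulVec ((J * R)⁻¹.mulVec y), ?_⟩
  have h1 : J.mulVec (R.mulVec ((J * R)⁻¹.mulVec y)) = y := by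
    rw [Matrix.mulVec_mulVec, Matrix.mulVec_mulVec, Matrix.mul_nonsing_inv _ hR, Matrix.one_mulVec]
  conv_rhs => rw [← h1]
  ext i
  rw [Matrix.mulVec, dotProduct]
  simp [J]

/-- A nonzero polynomial does not vanish identically on a nonempty open set. -/
theorem exists_eval_ne_zero_of_isOpen {w : ℕ} {Q : MvPolynomial (Fin w) ℂ} (hQ : Q ≠ 0)
    {U : Set (Fin w → ℂ)} (hU : IsOpen U) (hne : U.Nonempty) :
    ∃ y ∈ U, MvPolynomial.eval y Q ≠ 0 := by
  by_contra! h
  obtain ⟨y, hy⟩ := hne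
  obtain ⟨ε, hε, hb⟩ := Metric.isOpen_iff.1 hU y hy
  refine hQ (MvPolynomial.funext_set (fun i => Metric.ball (y i) ε) (fun i => ?_) fun x hx => ?_)
  · exact infinite_of_mem_nhds (y i) (Metric.ball_mem_nhds _ hε)
  · rw [h x (hb ?_), map_zero]
    rwa [ball_pi _ hε]

open MvPolynomial in
/-- Consider a family of polynomial maps `t ↦ ∑ₖ zₖ Pₖ(t)` depending linearly on `z`. If finitely
many of their images cover a nonempty open set, then for generic `z` the map is open at some `t`
outside a given hypersurface. -/
theorem exists_generic_open {m w : ℕ} (P : Fin w → Fin w → MvPolynomial (Fin m) ℂ)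
    {δ : MvPolynomial (Fin m) ℂ} (hδ : δ ≠ 0) {U : Set (Fin w → ℂ)} (hU : IsOpen U)
    (hne : U.Nonempty) {Z : Set (Fin w → ℂ)} (hZ : Z.Finite)
    (hcov : ∀ y ∈ U, ∃ z ∈ Z, ∃ t, ∀ i, y i = ∑ k, z k * eval t (P k i)) :
    ∃ D : MvPolynomial (Fin w) ℂ, D ≠ 0 ∧ ∀ z, eval z D ≠ 0 → ∃ t, eval t δ ≠ 0 ∧
      map (fun t i => ∑ k, z k * eval t (P k i)) (𝓝 t) = 𝓝 (fun i => ∑ k, z k * eval t (P k i)) := by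
  let F : (Fin w → ℂ) → Fin w → MvPolynomial (Fin m) ℂ := fun z i => ∑ k, C (z k) * P k i
  have hFe : ∀ z t i, eval t (F z i) = ∑ k, z k * eval t (P k i) := by
    intro z t i
    simp [F]
  -- Otherwise every `F z` satisfies a nonzero polynomial `Q z`. The finite product of the `Q z`
  -- over `Z` is nonzero but vanishes on `U`.
  obtain ⟨z₀, hz₀⟩ : ∃ z₀, AlgebraicIndependent ℂ (F z₀) := by
    by_contra! hdep
    have hQ : ∀ z, ∃ Q : MvPolynomial (Fin w) ℂ, aeval (F z) Q = 0 ∧ Q ≠ 0 := by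
      intro z
      have := hdep z
      rw [algebraicIndependent_iff] at this
      push Not at this
      exact this
    choose Q hQ0 hQne using hQ
    have hprod : ∏ z ∈ hZ.toFinset, Q z ≠ 0 := Finset.prod_ne_zero_iff.2 fun z _ => hQne z
    obtain ⟨y, hy, hne⟩ := exists_eval_ne_zero_of_isOpen hprod hU hne
    obtain ⟨z, hz, t, ht⟩ := hcov y hy
    rw [map_prod, Finset.prod_ne_zero_iff] at hne
    refine hne z (hZ.mem_toFinset.2 hz) ?_
    have h1 := congrArg (eval t) (hQ0 z)
    have h2 : y = fun i => eval t (F z i) := by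
      funext i
      rw [ht, hFe]
    rw [h2]
    rw [← map_zero (eval t), ← h1]
    exact (eval₂Hom_bind₁ (RingHom.id ℂ) t (F z) (Q z)).symm
  obtain ⟨R, d, hd, hR⟩ := exists_jacobian_mul_eq hz₀
  obtain ⟨t, -, ht⟩ := exists_eval_ne_zero_of_isOpen (mul_ne_zero hd hδ) isOpen_univ Set.univ_nonempty
  rw [map_mul] at ht
  have hdt := left_ne_zero_of_mul ht
  -- With `t` and `R` fixed from `z₀`, the matrix `J(F z)(t) * R(t)` is linear in `z`. Its
  -- determinant is the required `D`, and at `z₀` it equals `d(t) ^ w`.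
  let M : Matrix (Fin w) (Fin w) (MvPolynomial (Fin w) ℂ) := Matrix.of fun i k =>
    ∑ l, X l * C (∑ j, eval t (pderiv j (P l i)) * eval t (R j k))
  have hM : ∀ z, eval z M.det = (Matrix.of (fun i j => eval t (pderiv j (F z i))) *
      R.map (eval t)).det := by
    intro z
    rw [RingHom.map_det]
    congr 1
    ext i k
    simp [M, Matrix.mul_apply, F, Finset.sum_mul, Finset.mul_sum, map_sum, mul_assoc]
    rw [Finset.sum_comm]
  have hz₀M : eval z₀ M.det ≠ 0 := by
    have h1 := congrArg (fun A => (A.map (eval t)).det) hR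
    rw [hM]
    have h2 : ((Matrix.scalar (Fin w) d).map (eval t)) = Matrix.scalar (Fin w) (eval t d) := by
      ext i k
      by_cases hik : i = k
      · subst hik; simp
      · simp [hik]
    simp only [Matrix.map_mul, Matrix.scalar_apply] at h1 h2
    rw [h2, Matrix.det_diagonal] at h1
    refine ne_of_eq_of_ne h1 ?_
    simpa using pow_ne_zero _ hdt
  refine ⟨M.det, fun h => hz₀M (by rw [h, map_zero]), fun z hz => ⟨t, right_ne_zero_of_mul ht, ?_⟩⟩
  simp_rw [← hFe]
  exact map_nhds_eval_eq (F z) t (R.map (eval t)) (by rw [← hM]; exact hz.isUnit)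

/-! ### Linearity of jets and polynomial dependence of composition -/

section JetLinear

variable {n r : ℕ} {F : Type} [NormedAddCommGroup F] [NormedSpace ℂ F]

theorem jet_add [CompleteSpace F] {f g : (Fin n → ℂ) → F} (hf : AnalyticAt ℂ f 0)
    (hg : AnalyticAt ℂ g 0) : jet r (f + g) = jet r f + jet r g := by
  funext k
  exact iteratedFDeriv_add_apply hf.contDiffAt hg.contDiffAt

theorem jet_smul [CompleteSpace F] (c : ℂ) {f : (Fin n → ℂ) → F} (hf : AnalyticAt ℂ f 0) :
    jet r (c • f) = c • jet r f := by
  funext k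
  exact iteratedFDeriv_const_smul_apply hf.contDiffAt

instance (k : ℕ) [FiniteDimensional ℂ F] :
    FiniteDimensional ℂ (ContinuousMultilinearMap ℂ (fun _ : Fin k => Fin n → ℂ) F) :=
  Module.Finite.of_injective
    (ContinuousMultilinearMap.toMultilinearMapLinear :
      ContinuousMultilinearMap ℂ (fun _ : Fin k => Fin n → ℂ) F →ₗ[ℂ] _)
    ContinuousMultilinearMap.toMultilinearMap_injective

/-- The `r`-jet as a linear map on a space of maps analytic at the origin. -/
def jetLinear [CompleteSpace F] (r : ℕ) (A : Submodule ℂ ((Fin n → ℂ) → F))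
    (hA : ∀ f ∈ A, AnalyticAt ℂ f 0) : A →ₗ[ℂ] Jet n r F where
  toFun f := jet r f.1
  map_add' f g := jet_add (hA _ f.2) (hA _ g.2)
  map_smul' c f := jet_smul c (hA _ f.2)

/-- The first derivative is part of the jet. -/
theorem fderiv_eq_of_jet_eq (hr : 1 ≤ r) {f g : (Fin n → ℂ) → F} (h : jet r f = jet r g) :
    fderiv ℂ f 0 = fderiv ℂ g 0 := by
  have h1 : iteratedFDeriv ℂ 1 f 0 = iteratedFDeriv ℂ 1 g 0 :=
    congrFun h ⟨1, Nat.lt_succ_of_le hr⟩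
  ext1 v
  have h2 := congrArg (fun T => T (fun _ => v)) h1
  simpa [iteratedFDeriv_one_apply] using h2

end JetLinear

/-- The values of a linear map on a vector space are finite linear combinations of finitely many
of its values if the target has finite dimension. -/
theorem exists_fin_spanning {A W : Type*} [AddCommGroup A] [Module ℂ A] [AddCommGroup W]
    [Module ℂ W] [FiniteDimensional ℂ W] (L : A →ₗ[ℂ] W) :
    ∃ (m : ℕ) (ε : Fin m → A), ∀ a, ∃ t : Fin m → ℂ, L a = L (∑ i, t i • ε i) := by
  let b := Module.finBasis ℂ L.range
  choose ε hε using fun i => (b i).2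
  refine ⟨_, ε, fun a => ⟨b.repr ⟨L a, L.mem_range_self a⟩, ?_⟩⟩
  have h := congrArg Subtype.val (b.sum_repr ⟨L a, L.mem_range_self a⟩)
  simp only [map_sum, map_smul, hε]
  refine h.symm.trans ?_
  simp [-Module.Basis.sum_repr]

/-- A multilinear map evaluated at vectors depending linearly on parameters is a polynomial in the
parameters. -/
theorem exists_polynomial_of_multilinear {m k : ℕ} {E : Fin k → Type*}
    [∀ i, AddCommGroup (E i)] [∀ i, Module ℂ (E i)] (M : MultilinearMap ℂ E ℂ)
    (v : ∀ i, Fin m → E i) :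
    ∃ p : MvPolynomial (Fin m) ℂ, ∀ t : Fin m → ℂ,
      M (fun i => ∑ l, t l • v i l) = MvPolynomial.eval t p := by
  refine ⟨∑ σ : Fin k → Fin m, (∏ i, MvPolynomial.X (σ i)) *
    MvPolynomial.C (M fun i => v i (σ i)), fun t => ?_⟩
  rw [M.map_sum]
  simp [MultilinearMap.map_smul_univ]

/-- The jet of `f ∘ φ` depends polynomially on `φ` in a finite-dimensional family. -/
theorem exists_polynomial_jet_comp {n r m : ℕ} {f : (Fin n → ℂ) → ℂ} (hf : AnalyticAt ℂ f 0)
    {ε : Fin m → (Fin n → ℂ) → Fin n → ℂ} (hε : ∀ i, AnalyticAt ℂ (ε i) 0)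
    (hε0 : ∀ i, ε i 0 = 0) (L : Jet n r ℂ →ₗ[ℂ] ℂ) :
    ∃ p : MvPolynomial (Fin m) ℂ, ∀ t : Fin m → ℂ,
      L (jet r (f ∘ ∑ i, t i • ε i)) = MvPolynomial.eval t p := by
  -- Each Faà di Bruno term is multilinear in the derivatives of `φ`, which are linear in `t`.
  have key : ∀ k : Fin (r + 1), ∀ c : OrderedFinpartition (k : ℕ),
      ∃ p : MvPolynomial (Fin m) ℂ, ∀ t : Fin m → ℂ,
        L (Pi.single k (c.compAlongOrderedFinpartition (iteratedFDeriv ℂ c.length f 0)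
          (fun j => ∑ l, t l • iteratedFDeriv ℂ (c.partSize j) (ε l) 0)))
        = MvPolynomial.eval t p := fun k c =>
    exists_polynomial_of_multilinear
      ((L ∘ₗ LinearMap.single ℂ _ k).compMultilinearMap
        (c.compAlongOrderedFinpartitionₗ (iteratedFDeriv ℂ c.length f 0)))
      (fun j l => iteratedFDeriv ℂ (c.partSize j) (ε l) 0)
  choose p hp using key
  refine ⟨∑ k, ∑ c, p k c, fun t => ?_⟩
  set φ := ∑ i, t i • ε i with hφ
  have hφa : AnalyticAt ℂ φ 0 := by
    rw [hφ]
    exact Finset.analyticAt_sum _ fun i _ => (hε i).const_smul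
  have hφ0 : φ 0 = 0 := by simp [hφ, hε0]
  have hφd : ∀ k : ℕ, iteratedFDeriv ℂ k φ 0 = ∑ l, t l • iteratedFDeriv ℂ k (ε l) 0 := by
    intro k
    rw [hφ, iteratedFDeriv_sum_apply fun i _ => ((hε i).const_smul (c := t i)).contDiffAt]
    exact Finset.sum_congr rfl fun i _ => iteratedFDeriv_const_smul_apply (hε i).contDiffAt
  have hj : jet r (f ∘ φ) = ∑ k, Pi.single k (jet r (f ∘ φ) k) :=
    (Finset.univ_sum_single _).symm
  rw [hj, map_sum, map_sum]
  refine Finset.sum_congr rfl fun k _ => ?_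
  have hcd : ContDiffAt ℂ (k : ℕ) f (φ 0) := by rw [hφ0]; exact hf.contDiffAt
  have h1 : jet r (f ∘ φ) k = ∑ c : OrderedFinpartition (k : ℕ),
      c.compAlongOrderedFinpartition (iteratedFDeriv ℂ c.length f 0)
          (fun j => ∑ l, t l • iteratedFDeriv ℂ (c.partSize j) (ε l) 0) := by
    change iteratedFDeriv ℂ (k : ℕ) (f ∘ φ) 0 = _
    rw [iteratedFDeriv_comp hcd hφa.contDiffAt le_rfl, hφ0]
    simp_rw [← hφd]
    rfl
  rw [h1, ← LinearMap.single_apply (R := ℂ), map_sum, map_sum, map_sum]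
  exact Finset.sum_congr rfl fun c _ => hp k c t

/-! ### Orbits in linear coordinates -/

variable {G : Type*} [Group G] {n : ℕ}

/-- The analytic maps `(ℂⁿ, 0) → (ℂⁿ, 0)` with equivariant germ. -/
def equivMaps (ρ : Representation ℂ G (Fin n → ℂ)) :
    Submodule ℂ ((Fin n → ℂ) → Fin n → ℂ) where
  carrier := {φ | AnalyticAt ℂ φ 0 ∧ φ 0 = 0 ∧ ∀ g, ∀ᶠ x in 𝓝 0, φ (ρ g x) = ρ g (φ x)}
  add_mem' := by
    rintro φ ψ ⟨h1, h2, h3⟩ ⟨k1, k2, k3⟩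
    refine ⟨h1.add k1, by simp [h2, k2], fun g => ?_⟩
    filter_upwards [h3 g, k3 g] with x hx kx
    simp [hx, kx]
  zero_mem' := ⟨analyticAt_const, rfl, fun g => by simp⟩
  smul_mem' := by
    rintro c φ ⟨h1, h2, h3⟩
    refine ⟨h1.const_smul, by simp [h2], fun g => ?_⟩
    filter_upwards [h3 g] with x hx
    simp [hx]

/-- The invariant analytic functions `(ℂⁿ, 0) → (ℂ, 0)` with a critical point at the origin. -/
def critInv (ρ : Representation ℂ G (Fin n → ℂ)) : Submodule ℂ ((Fin n → ℂ) → ℂ) where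
  carrier := {f | AnalyticAt ℂ f 0 ∧ f 0 = 0 ∧ fderiv ℂ f 0 = 0 ∧
    ∀ g, ∀ᶠ x in 𝓝 0, f (ρ g x) = f x}
  add_mem' := by
    rintro φ ψ ⟨h1, h2, h3, h4⟩ ⟨k1, k2, k3, k4⟩
    refine ⟨h1.add k1, by simp [h2, k2], ?_, fun g => ?_⟩
    · rw [fderiv_add h1.differentiableAt k1.differentiableAt, h3, k3, add_zero]
    · filter_upwards [h4 g, k4 g] with x hx kx
      simp [hx, kx]
  zero_mem' := ⟨analyticAt_const, rfl, by simp, fun g => by simp⟩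
  smul_mem' := by
    rintro c φ ⟨h1, h2, h3, h4⟩
    refine ⟨h1.const_smul, by simp [h2], ?_, fun g => ?_⟩
    · rw [fderiv_const_smul h1.differentiableAt, h3, smul_zero]
    · filter_upwards [h4 g] with x hx
      simp [hx]

variable {ρ : Representation ℂ G (Fin n → ℂ)}

theorem CritInvGerm.mem_critInv (f : CritInvGerm ρ) : f.toFun ∈ critInv ρ :=
  ⟨f.analytic, f.map_zero, f.critical, f.invariant⟩

/-- A member of `critInv ρ` as a germ. -/
def CritInvGerm.ofMem {f : (Fin n → ℂ) → ℂ} (hf : f ∈ critInv ρ) : CritInvGerm ρ :=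
  ⟨f, hf.1, hf.2.1, hf.2.2.1, hf.2.2.2⟩

theorem EquivDiffeo.mem_equivMaps (φ : EquivDiffeo ρ) : φ.toFun ∈ equivMaps ρ :=
  ⟨φ.analytic, φ.map_zero, φ.equivariant⟩

theorem comp_mem_critInv {f : (Fin n → ℂ) → ℂ} {φ : (Fin n → ℂ) → Fin n → ℂ}
    (hf : f ∈ critInv ρ) (hφ : φ ∈ equivMaps ρ) : f ∘ φ ∈ critInv ρ := by
  obtain ⟨h1, h2, h3, h4⟩ := hf
  obtain ⟨k1, k2, k3⟩ := hφ
  refine ⟨h1.comp_of_eq k1 k2, by simp [k2, h2], ?_, fun g => ?_⟩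
  · rw [fderiv_comp _ (by rw [k2]; exact h1.differentiableAt) k1.differentiableAt, k2, h3]
    simp
  · have h5 : Tendsto φ (𝓝 0) (𝓝 0) := by simpa [k2] using k1.continuousAt.tendsto
    filter_upwards [k3 g, h5.eventually (h4 g)] with x hx kx
    simp [hx, kx]

/-- The inverse function theorem for equivariant germs. -/
theorem exists_equivDiffeo {φ : (Fin n → ℂ) → Fin n → ℂ} (hφ : φ ∈ equivMaps ρ)
    (hdet : (fderiv ℂ φ 0).det ≠ 0) : ∃ Φ : EquivDiffeo ρ, Φ.toFun = φ := by
  obtain ⟨h1, h2, h3⟩ := hφ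
  let D := (fderiv ℂ φ 0).toContinuousLinearEquivOfDetNeZero hdet
  have hD : HasStrictFDerivAt φ (D : (Fin n → ℂ) →L[ℂ] (Fin n → ℂ)) 0 := by
    simpa [D] using h1.hasStrictFDerivAt
  -- The exponent `⊤` is the analytic class, so the local inverse comes out analytic.
  have hcd : ContDiffAt ℂ ⊤ φ 0 := h1.contDiffAt
  have hinv : AnalyticAt ℂ (hD.localInverse φ D 0) 0 := by
    have h := hcd.to_localInverse hD.hasFDerivAt (by simp)
    rw [h2] at h
    exact h.analyticAt
  refine ⟨⟨φ, hD.localInverse φ D 0, h1, hinv, h2, ?_, ?_, ?_, h3⟩, rfl⟩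
  · simpa [h2] using hD.localInverse_apply_image
  · exact hD.eventually_left_inverse
  · simpa [h2] using hD.eventually_right_inverse

/-- The chain rule for `invFun ∘ toFun = id`. This puts the parameters of a diffeomorphism jet off
the hypersurface `δ = 0`. -/
theorem EquivDiffeo.det_fderiv_ne_zero (φ : EquivDiffeo ρ) : (fderiv ℂ φ.toFun 0).det ≠ 0 := by
  have h1 : fderiv ℂ (φ.invFun ∘ φ.toFun) 0 = ContinuousLinearMap.id ℂ _ := by
    have h : φ.invFun ∘ φ.toFun =ᶠ[𝓝 0] id := φ.left_inv
    rw [h.fderiv_eq, fderiv_id]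
  rw [fderiv_comp _ (by rw [φ.map_zero]; exact φ.analytic_inv.differentiableAt)
    φ.analytic.differentiableAt] at h1
  have h2 := congrArg ContinuousLinearMap.det h1
  rw [ContinuousLinearMap.det, ContinuousLinearMap.det, ContinuousLinearMap.toLinearMap_comp,
    LinearMap.det_comp] at h2
  exact right_ne_zero_of_mul (ne_of_eq_of_ne h2 (by simp))

open MvPolynomial in
/-- For `r ≥ 1` the orbits of `D^r_G` in `O^r_G` are, in suitable linear coordinates, images of
the complement of a hypersurface under polynomial maps depending linearly on the base point. -/
theorem exists_coordinates (ρ : Representation ℂ G (Fin n → ℂ)) {r : ℕ} (hr : 1 ≤ r) :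
    ∃ (w m : ℕ) (κ : FunJets ρ r ≃ₜ (Fin w → ℂ)) (ℓ : Fin w → Jet n r ℂ →ₗ[ℂ] ℂ)
      (P : Fin w → Fin w → MvPolynomial (Fin m) ℂ) (δ : MvPolynomial (Fin m) ℂ),
      (∀ x i, κ x i = ℓ i x.1) ∧ δ ≠ 0 ∧
      (∀ a : DiffeoJets ρ r, ∃ t, eval t δ ≠ 0 ∧
        ∀ x i, κ (a • x) i = ∑ k, κ x k * eval t (P k i)) ∧
      (∀ t, eval t δ ≠ 0 → ∃ a : DiffeoJets ρ r,
        ∀ x i, κ (a • x) i = ∑ k, κ x k * eval t (P k i)) := by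
  let JF := jetLinear r (critInv ρ) fun _ h => h.1
  let JE := jetLinear r (equivMaps ρ) fun _ h => h.1
  obtain ⟨m, ε, hε⟩ := exists_fin_spanning JE
  have hφ : ∀ t : Fin m → ℂ, ∑ i, t i • (ε i).1 ∈ equivMaps ρ := fun t =>
    Submodule.sum_mem _ fun i _ => Submodule.smul_mem _ _ (ε i).2
  have hspan : ∀ φ ∈ equivMaps ρ, ∃ t : Fin m → ℂ, jet r φ = jet r (∑ i, t i • (ε i).1) := by
    intro φ h
    obtain ⟨t, ht⟩ := hε ⟨φ, h⟩
    refine ⟨t, ht.trans ?_⟩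
    change jet r (Subtype.val _) = _
    simp
  -- the determinant of the linear part
  let δ : MvPolynomial (Fin m) ℂ := (Matrix.of fun i j =>
    ∑ l, X l * C (LinearMap.toMatrix' (fderiv ℂ (ε l).1 0).toLinearMap i j)).det
  have hδ : ∀ t, eval t δ = (fderiv ℂ (∑ i, t i • (ε i).1) 0).det := by
    intro t
    have h1 : fderiv ℂ (∑ i, t i • (ε i).1) 0 = ∑ i, t i • fderiv ℂ (ε i).1 0 := by
      rw [fderiv_sum fun i _ => ((ε i).2.1.const_smul (c := t i)).differentiableAt]
      exact Finset.sum_congr rfl fun i _ => fderiv_const_smul (ε i).2.1.differentiableAt _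
    rw [h1, ContinuousLinearMap.det, ← LinearMap.det_toMatrix', RingHom.map_det]
    congr 1
    ext i j
    simp [LinearMap.toMatrix'_apply, Finset.sum_apply]
  have hδE : ∀ (Φ : EquivDiffeo ρ) (t : Fin m → ℂ), jet r Φ.toFun = jet r (∑ i, t i • (ε i).1) →
      eval t δ ≠ 0 := by
    intro Φ t h
    rw [hδ, ← fderiv_eq_of_jet_eq hr h]
    exact Φ.det_fderiv_ne_zero
  have : Module.Free ℂ JF.range := Module.Free.of_divisionRing ℂ JF.range
  let b := Module.finBasis ℂ JF.range
  choose β hβ using fun k => (b k).2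
  -- As a set of jets, `O^r_G` is the range of a linear map, which provides linear coordinates.
  let ι : FunJets ρ r ≃ₜ JF.range := Homeomorph.setCongr (by
    ext j
    constructor
    · rintro ⟨f, rfl⟩
      exact ⟨⟨f.toFun, f.mem_critInv⟩, rfl⟩
    · rintro ⟨f, rfl⟩
      exact ⟨CritInvGerm.ofMem f.2, rfl⟩)
  let κ := ι.trans b.equivFunL.toHomeomorph
  choose ℓ hℓ using fun i => LinearMap.exists_extend (b.coord i)
  have hκ : ∀ x i, κ x i = ℓ i x.1 := fun x i =>
    (LinearMap.congr_fun (hℓ i) (ι x)).symm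
  choose P hP using fun k i => exists_polynomial_jet_comp (r := r) (β k).2.1
    (fun l => (ε l).2.1) (fun l => (ε l).2.2.1) (ℓ i)
  have hpull : ∀ (f : CritInvGerm ρ) (y : FunJets ρ r) (φ : (Fin n → ℂ) → Fin n → ℂ)
      (t : Fin m → ℂ), φ ∈ equivMaps ρ → jet r φ = jet r (∑ i, t i • (ε i).1) →
      y.1 = jet r (f.toFun ∘ φ) → ∀ i, κ y i = ∑ k, κ (f.jet r) k * eval t (P k i) := by
    intro f y φ t hφm hφt hy i
    have h1 : jet r f.toFun = jet r (∑ k, κ (f.jet r) k • (β k).1) := by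
      have h2 := congrArg Subtype.val (b.sum_repr (ι (f.jet r)))
      refine h2.symm.trans ?_
      have h3 : jet r (∑ k, κ (f.jet r) k • (β k).1) = JF (∑ k, κ (f.jet r) k • β k) := by
        change _ = jet r (Subtype.val _)
        simp
      rw [h3, map_sum, AddSubmonoidClass.coe_finsetSum]
      refine Finset.sum_congr rfl fun k _ => ?_
      rw [map_smul, hβ]
      rfl
    have h2 : y.1 = ∑ k, κ (f.jet r) k • jet r ((β k).1 ∘ ∑ i, t i • (ε i).1) := by
      rw [hy, jet_comp_congr f.analytic
        (Submodule.sum_mem (critInv ρ) fun k _ => Submodule.smul_mem _ _ (β k).2).1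
        hφm.1 (hφ t).1 hφm.2.1 (hφ t).2.1 h1 hφt]
      have h3 : (∑ k, κ (f.jet r) k • (β k).1) ∘ (∑ i, t i • (ε i).1)
          = ((∑ k, κ (f.jet r) k • ⟨_, comp_mem_critInv (β k).2 (hφ t)⟩ : critInv ρ) :
            (Fin n → ℂ) → ℂ) := by
        funext x
        simp [Finset.sum_apply]
      rw [h3]
      change JF _ = _
      rw [map_sum]
      exact Finset.sum_congr rfl fun k _ => map_smul JF _ _
    rw [hκ, h2, map_sum]
    refine Finset.sum_congr rfl fun k _ => ?_
    rw [map_smul, hP, smul_eq_mul]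
  refine ⟨_, m, κ, ℓ, P, δ, hκ, ?_, ?_, ?_⟩
  · obtain ⟨t, ht⟩ := hspan _ (EquivDiffeo.refl ρ).mem_equivMaps
    intro h
    exact hδE _ t ht (by rw [h, map_zero])
  · rintro ⟨Φ⟩
    -- The action is by `f ∘ Φ⁻¹`, so the parameters are those of the inverse germ.
    obtain ⟨t, ht⟩ := hspan _ Φ.symm.mem_equivMaps
    refine ⟨t, hδE _ t ht, ?_⟩
    rintro ⟨_, f, rfl⟩ i
    exact hpull f _ _ t Φ.symm.mem_equivMaps ht (congrArg Subtype.val (smul_jet (r := r) Φ f)) i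
  · intro t ht
    obtain ⟨Φ, hΦ⟩ := exists_equivDiffeo (hφ t) (by rwa [← hδ])
    refine ⟨Φ.symm.jet r, ?_⟩
    rintro ⟨_, f, rfl⟩ i
    refine hpull f _ Φ.toFun t Φ.mem_equivMaps (by rw [hΦ]) ?_ i
    exact congrArg Subtype.val (smul_jet (r := r) Φ.symm f)

open MvPolynomial in
/-- If an open subset of `O^r_G` meets finitely many orbits only, then the orbit of a generic jet
is open. -/
theorem exists_generic_isOpen_orbit (ρ : Representation ℂ G (Fin n → ℂ)) {r : ℕ} (hr : 1 ≤ r)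
    {U : Set (FunJets ρ r)} (hU : IsOpen U) (hne : U.Nonempty)
    (hfin : {S : Set (FunJets ρ r) | (∃ j, S = MulAction.orbit (DiffeoJets ρ r) j) ∧
      (S ∩ U).Nonempty}.Finite) :
    ∃ (w : ℕ) (ℓ : Fin w → Jet n r ℂ →ₗ[ℂ] ℂ) (D : MvPolynomial (Fin w) ℂ),
      (∃ x : FunJets ρ r, eval (fun i => ℓ i x.1) D ≠ 0) ∧
      ∀ x : FunJets ρ r, eval (fun i => ℓ i x.1) D ≠ 0 →
        IsOpen (MulAction.orbit (DiffeoJets ρ r) x) := by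
  obtain ⟨w, m, κ, ℓ, P, δ, hκ, hδ, hto, hof⟩ := exists_coordinates ρ hr
  have hκ' : ∀ x : FunJets ρ r, (fun i => ℓ i x.1) = κ x := fun x => funext fun i => (hκ x i).symm
  have hcont : ContinuousConstSMul (DiffeoJets ρ r) (FunJets ρ r) := by
    refine ⟨fun a => ?_⟩
    obtain ⟨t, -, ht⟩ := hto a
    rw [← κ.comp_continuous_iff]
    refine continuous_pi fun i => ?_
    simp only [Function.comp_apply, ht]
    fun_prop
  choose rep hrep using fun S : {S : Set (FunJets ρ r) |
    (∃ j, S = MulAction.orbit (DiffeoJets ρ r) j) ∧ (S ∩ U).Nonempty} => S.2.1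
  have := hfin.to_subtype
  obtain ⟨D, hD, hDopen⟩ := exists_generic_open P hδ (U := κ '' U) (κ.isOpenMap _ hU)
    (hne.image _) (Z := Set.range fun S => κ (rep S)) (Set.finite_range _) (by
      rintro _ ⟨y, hy, rfl⟩
      let S : {S : Set (FunJets ρ r) | (∃ j, S = MulAction.orbit (DiffeoJets ρ r) j) ∧
        (S ∩ U).Nonempty} := ⟨MulAction.orbit (DiffeoJets ρ r) y, ⟨y, rfl⟩,
          y, MulAction.mem_orbit_self y, hy⟩
      have hyS : y ∈ MulAction.orbit (DiffeoJets ρ r) (rep S) := by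
        rw [← hrep S]
        exact MulAction.mem_orbit_self y
      obtain ⟨a, ha⟩ := hyS
      obtain ⟨t, -, ht⟩ := hto a
      exact ⟨_, ⟨S, rfl⟩, t, fun i => by rw [← ht, ← ha]⟩)
  refine ⟨w, ℓ, D, ?_, fun x hx => ?_⟩
  · obtain ⟨y, -, hy⟩ := exists_eval_ne_zero_of_isOpen hD isOpen_univ Set.univ_nonempty
    refine ⟨κ.symm y, ?_⟩
    rwa [hκ', κ.apply_symm_apply]
  · rw [hκ'] at hx
    obtain ⟨t, ht, hmap⟩ := hDopen _ hx
    obtain ⟨a, ha⟩ := hof t ht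
    have hnhds : MulAction.orbit (DiffeoJets ρ r) x ∈ 𝓝 (a • x) := by
      have h1 : κ '' MulAction.orbit (DiffeoJets ρ r) x ∈ 𝓝 (κ (a • x)) := by
        have h2 : κ (a • x) = fun i => ∑ k, κ x k * eval t (P k i) := funext (ha x)
        rw [h2, ← hmap]
        have h3 : ∀ᶠ s in 𝓝 t, eval s δ ≠ 0 :=
          (MvPolynomial.continuous_eval δ).continuousAt.eventually_ne ht
        refine mem_map.2 (h3.mono fun s hs => ?_)
        obtain ⟨c, hc⟩ := hof s hs
        exact ⟨c • x, ⟨c, rfl⟩, funext (hc x)⟩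
      have h4 := κ.continuous.continuousAt.preimage_mem_nhds h1
      rwa [κ.injective.preimage_image] at h4
    -- The orbit is a neighbourhood of `a • x`; the homeomorphism `a * c⁻¹` pulls this back to `c •
    -- x`.
    rw [isOpen_iff_mem_nhds]
    rintro _ ⟨c, rfl⟩
    have h5 := (continuous_const_smul (a * c⁻¹) : Continuous fun y : FunJets ρ r => (a * c⁻¹) • y)
      |>.continuousAt (x := c • x)
    have h6 : (a * c⁻¹) • c • x = a • x := by rw [smul_smul, inv_mul_cancel_right]
    have h7 := h5.preimage_mem_nhds (t := MulAction.orbit (DiffeoJets ρ r) x) (by rwa [h6])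
    refine mem_of_superset h7 fun y hy => ?_
    obtain ⟨d, hd⟩ := hy
    refine ⟨(a * c⁻¹)⁻¹ * d, ?_⟩
    change ((a * c⁻¹)⁻¹ * d) • x = y
    rw [mul_smul, show d • x = (a * c⁻¹) • y from hd, inv_smul_smul]

/-! ### Baire category: one germ for all jet orders -/

open MvPolynomial in
/-- A polynomial condition on a topological vector space that holds somewhere holds on a
dense set. -/
theorem dense_eval_ne_zero {w : ℕ} {V : Type*} [AddCommGroup V] [Module ℂ V] [TopologicalSpace V]
    [ContinuousAdd V] [ContinuousSMul ℂ V] (T : V →ₗ[ℂ] (Fin w → ℂ)) {D : MvPolynomial (Fin w) ℂ}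
    {v₀ : V} (h : eval (T v₀) D ≠ 0) : Dense {v | eval (T v) D ≠ 0} := by
  intro v
  -- Restriction of `D` to the line from `v` to `v₀`. It is nonzero at parameter `1`, so it has
  -- finitely many roots and small `s ≠ 0` avoid them.
  let p : Polynomial ℂ := aeval (fun i => Polynomial.C (T v i) +
    Polynomial.X * Polynomial.C (T (v₀ - v) i)) D
  have hp : ∀ s : ℂ, p.eval s = eval (T (v + s • (v₀ - v))) D := by
    intro s
    have h1 := eval₂_comp_left (Polynomial.evalRingHom s) (algebraMap ℂ (Polynomial ℂ))
      (fun i => Polynomial.C (T v i) + Polynomial.X * Polynomial.C (T (v₀ - v) i)) D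
    refine h1.trans ?_
    rw [← eval₂_id]
    congr 1
    · ext a; simp
    · ext i; simp
  have hp0 : p ≠ 0 := by
    intro h0
    have h1 := hp 1
    rw [h0, one_smul, add_sub_cancel, Polynomial.eval_zero] at h1
    exact h h1.symm
  have h1 : Tendsto (fun s : ℂ => v + s • (v₀ - v)) (𝓝[≠] 0) (𝓝 v) := by
    have h2 : Continuous fun s : ℂ => v + s • (v₀ - v) := by fun_prop
    simpa using (h2.tendsto 0).mono_left nhdsWithin_le_nhds
  refine mem_closure_of_tendsto h1 ?_
  have h3 : {s : ℂ | p.IsRoot s}.Finite := Polynomial.finite_setOfPred_isRoot hp0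
  have h4 : (({s : ℂ | p.IsRoot s} \ {0})ᶜ : Set ℂ) ∈ 𝓝 (0 : ℂ) :=
    (h3.subset Set.sdiff_subset).isClosed.isOpen_compl.mem_nhds (by simp)
  filter_upwards [mem_nhdsWithin_of_mem_nhds h4, self_mem_nhdsWithin] with s hs hs0
  rw [← hp]
  intro h5
  exact hs ⟨h5, hs0⟩

/-- Bounded sequences of multilinear forms, viewed as power series on the unit ball. -/
abbrev BddSeries (n : ℕ) : Type :=
  lp (fun k : ℕ => ContinuousMultilinearMap ℂ (fun _ : Fin k => Fin n → ℂ) ℂ) ⊤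

/-- The `k`-th term of a bounded series. -/
def coeffL (n k : ℕ) :
    BddSeries n →L[ℂ] ContinuousMultilinearMap ℂ (fun _ : Fin k => Fin n → ℂ) ℂ :=
  LinearMap.mkContinuous
    { toFun := fun q => q k
      map_add' := fun _ _ => rfl
      map_smul' := fun _ _ => rfl } 1
    fun q => by
      rw [one_mul]
      exact lp.norm_apply_le_norm ENNReal.top_ne_zero q k

/-- The symmetric invariant series without constant and linear terms. -/
def invSeries (ρ : Representation ℂ G (Fin n → ℂ)) : Submodule ℂ (BddSeries n) where
  carrier := {q | coeffL n 0 q = 0 ∧ coeffL n 1 q = 0 ∧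
    (∀ k (σ : Equiv.Perm (Fin k)) v, coeffL n k q (v ∘ σ) = coeffL n k q v) ∧
    ∀ g k v, coeffL n k q (fun i => ρ g (v i)) = coeffL n k q v}
  add_mem' := by
    rintro p q ⟨h1, h2, h3, h4⟩ ⟨k1, k2, k3, k4⟩
    exact ⟨by simp [h1, k1], by simp [h2, k2], fun k σ v => by simp [h3, k3],
      fun g k v => by simp [h4, k4]⟩
  zero_mem' := by simp
  smul_mem' := by
    rintro c q ⟨h1, h2, h3, h4⟩
    exact ⟨by ext v; simp [h1], by ext v; simp [h2],
      fun k σ v => by simp [h3], fun g k v => by simp [h4]⟩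

/-- Every defining condition equates continuous functions. Closedness gives the completeness that
Baire's theorem needs. -/
theorem isClosed_invSeries (ρ : Representation ℂ G (Fin n → ℂ)) :
    IsClosed (invSeries ρ : Set (BddSeries n)) := by
  have hc : ∀ k (v : Fin k → Fin n → ℂ), Continuous fun q : BddSeries n => coeffL n k q v :=
    fun k v => (ContinuousMultilinearMap.apply ℂ (fun _ : Fin k => Fin n → ℂ) ℂ v).continuous.comp
      (coeffL n k).continuous
  refine (isClosed_eq (coeffL n 0).continuous continuous_const).inter
    ((isClosed_eq (coeffL n 1).continuous continuous_const).inter (.inter ?_ ?_))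
  · change IsClosed {q : BddSeries n | ∀ k (σ : Equiv.Perm (Fin k)) v,
      coeffL n k q (v ∘ σ) = coeffL n k q v}
    simp only [Set.ofPred_forall]
    exact isClosed_iInter fun k => isClosed_iInter fun σ => isClosed_iInter fun v =>
      isClosed_eq (hc k _) (hc k _)
  · change IsClosed {q : BddSeries n | ∀ g k v, coeffL n k q (fun i => ρ g (v i)) = coeffL n k q v}
    simp only [Set.ofPred_forall]
    exact isClosed_iInter fun g => isClosed_iInter fun k => isClosed_iInter fun v =>
      isClosed_eq (hc k _) (hc k _)

/-- The power series given by a bounded sequence of multilinear forms. -/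
def toSeries (q : BddSeries n) : FormalMultilinearSeries ℂ (Fin n → ℂ) ℂ := fun k => coeffL n k q

/-- Bounded coefficients force the radius of convergence to be at least `1`. -/
theorem hasFPowerSeriesOnBall_toSeries (q : BddSeries n) :
    HasFPowerSeriesOnBall (toSeries q).sum (toSeries q) 0 (toSeries q).radius := by
  refine FormalMultilinearSeries.hasFPowerSeriesOnBall _ ?_
  refine lt_of_lt_of_le (ENNReal.coe_pos.2 one_pos)
    ((toSeries q).le_radius_of_bound (r := 1) ‖q‖ fun k => ?_)
  rw [NNReal.coe_one, one_pow, mul_one]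
  exact lp.norm_apply_le_norm ENNReal.top_ne_zero q k

theorem sum_mem_critInv {ρ : Representation ℂ G (Fin n → ℂ)} {q : BddSeries n}
    (hq : q ∈ invSeries ρ) : (toSeries q).sum ∈ critInv ρ := by
  obtain ⟨h0, h1, -, hinv⟩ := hq
  have h := (hasFPowerSeriesOnBall_toSeries q).hasFPowerSeriesAt
  refine ⟨h.analyticAt, ?_, ?_, fun g => Eventually.of_forall fun x => ?_⟩
  · rw [← h.coeff_zero Fin.elim0]
    change coeffL n 0 q _ = 0
    rw [h0]; rfl
  · rw [h.fderiv_eq]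
    change continuousMultilinearCurryFin1 ℂ (Fin n → ℂ) ℂ (coeffL n 1 q) = 0
    rw [h1, map_zero]
  · exact tsum_congr fun k => hinv g k fun _ => x

/-- The `k`-th derivative sums the coefficient over all permutations of its arguments; symmetry
makes the `k!` terms equal. -/
theorem jet_sum_toSeries {ρ : Representation ℂ G (Fin n → ℂ)} {q : BddSeries n}
    (hq : q ∈ invSeries ρ) (r : ℕ) :
    jet r (toSeries q).sum = fun k : Fin (r + 1) => ((k : ℕ).factorial : ℂ) • coeffL n k q := by
  funext k
  ext v
  change iteratedFDeriv ℂ (k : ℕ) _ 0 v = _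
  rw [(hasFPowerSeriesOnBall_toSeries q).iteratedFDeriv_eq_sum_of_completeSpace]
  have h : ∀ σ : Equiv.Perm (Fin (k : ℕ)), toSeries q k (fun i => v (σ i)) = coeffL n k q v :=
    fun σ => hq.2.2.1 k σ v
  simp [h, Fintype.card_perm]

/-- Every jet in `O^r_G` is the jet of a polynomial invariant. -/
theorem exists_invSeries {ρ : Representation ℂ G (Fin n → ℂ)} {r : ℕ} (x : FunJets ρ r) :
    ∃ q ∈ invSeries ρ, jet r (toSeries q).sum = x.1 := by
  obtain ⟨_, f, rfl⟩ := x
  -- The Taylor polynomial of degree `r`: truncation makes the sequence bounded, and the factor `1 /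
  -- k!` cancels the one in `jet_sum_toSeries`.
  let p : ∀ k : ℕ, ContinuousMultilinearMap ℂ (fun _ : Fin k => Fin n → ℂ) ℂ := fun k =>
    if k ≤ r then (k.factorial : ℂ)⁻¹ • iteratedFDeriv ℂ k f.toFun 0 else 0
  have hp : Memℓp p ⊤ := by
    refine memℓp_infty ((((Set.finite_Iic r).image fun k => ‖p k‖).union
      (Set.finite_singleton 0)).bddAbove.mono ?_)
    rintro _ ⟨k, rfl⟩
    by_cases hk : k ≤ r
    · exact Or.inl ⟨k, hk, rfl⟩
    · exact Or.inr (by simp [p, hk])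
  let q : BddSeries n := ⟨p, hp⟩
  have hqk : ∀ k, coeffL n k q = p k := fun k => rfl
  have hinv : ∀ g k (v : Fin k → Fin n → ℂ), iteratedFDeriv ℂ k f.toFun 0 (fun i => ρ g (v i))
      = iteratedFDeriv ℂ k f.toFun 0 v := by
    intro g k v
    let A : (Fin n → ℂ) ≃L[ℂ] (Fin n → ℂ) := (LinearEquiv.ofLinearMap (ρ g) (ρ g⁻¹)
      (by ext; simp [← Module.End.mul_apply, ← map_mul])
      (by ext; simp [← Module.End.mul_apply, ← map_mul])).toContinuousLinearEquiv
    have h1 : f.toFun ∘ A =ᶠ[𝓝 0] f.toFun := f.invariant g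
    have h2 := A.iteratedFDerivWithin_comp_right f.toFun uniqueDiffOn_univ
      (x := 0) (Set.mem_univ _) k
    rw [Set.preimage_univ, iteratedFDerivWithin_univ, iteratedFDerivWithin_univ, map_zero,
      (h1.iteratedFDeriv ℂ k).eq_of_nhds] at h2
    exact (congrArg (fun T => T v) h2).symm
  have hq : q ∈ invSeries ρ := by
    refine ⟨?_, ?_, fun k σ v => ?_, fun g k v => ?_⟩
    · ext v
      simp [hqk, p, f.map_zero]
    · ext v
      by_cases hr : 1 ≤ r
      · simp [hqk, p, hr, iteratedFDeriv_one_apply, f.critical]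
      · simp [hqk, p, hr]
    · rw [hqk]
      by_cases hk : k ≤ r
      · simp [p, hk, f.analytic.contDiffAt.iteratedFDeriv_comp_perm]
      · simp [p, hk]
    · rw [hqk]
      by_cases hk : k ≤ r
      · simp [p, hk, hinv]
      · simp [p, hk]
  refine ⟨q, hq, ?_⟩
  rw [jet_sum_toSeries hq]
  funext k
  have hk : (k : ℕ) ≤ r := Nat.lt_succ_iff.1 k.2
  have hk' : ((k : ℕ).factorial : ℂ) ≠ 0 := Nat.cast_ne_zero.2 (Nat.factorial_ne_zero _)
  rw [hqk]
  simp only [p, hk, if_true, smul_smul, mul_inv_cancel₀ hk', one_smul]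
  rfl

open MvPolynomial in
/-- There is a germ whose jets satisfy countably many generic conditions. -/
theorem exists_generic_germ (ρ : Representation ℂ G (Fin n → ℂ)) {w : ℕ → ℕ}
    (ℓ : ∀ r, Fin (w r) → Jet n r ℂ →ₗ[ℂ] ℂ) (D : ∀ r, MvPolynomial (Fin (w r)) ℂ)
    (hD : ∀ r, ∃ x : FunJets ρ r, eval (fun i => ℓ r i x.1) (D r) ≠ 0) :
    ∃ f : CritInvGerm ρ, ∀ r, eval (fun i => ℓ r i (f.jet r).1) (D r) ≠ 0 := by
  have : CompleteSpace (invSeries ρ) := (isClosed_invSeries ρ).completeSpace_coe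
  let T : ∀ r, invSeries ρ →L[ℂ] (Fin (w r) → ℂ) := fun r =>
    ContinuousLinearMap.pi fun i => (ℓ r i).toContinuousLinearMap ∘L
      (ContinuousLinearMap.pi fun k : Fin (r + 1) =>
        ((k : ℕ).factorial : ℂ) • coeffL n k ∘L (invSeries ρ).subtypeL)
  have hT : ∀ r (q : invSeries ρ), T r q = fun i => ℓ r i (jet r (toSeries q.1).sum) := by
    intro r q
    rw [jet_sum_toSeries q.2]
    rfl
  have hdense : Dense (⋂ r, {q | eval (T r q) (D r) ≠ 0}) := by
    refine dense_iInter_of_isOpen (fun r => ?_) fun r => ?_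
    · exact isOpen_ne_fun ((MvPolynomial.continuous_eval (D r)).comp (T r).continuous)
        continuous_const
    · obtain ⟨x, hx⟩ := hD r
      obtain ⟨q, hq, hqx⟩ := exists_invSeries x
      refine dense_eval_ne_zero (T r).toLinearMap (v₀ := ⟨q, hq⟩) ?_
      change eval (T r ⟨q, hq⟩) (D r) ≠ 0
      rwa [hT, hqx]
  obtain ⟨q, hq⟩ := hdense.nonempty
  refine ⟨CritInvGerm.ofMem (sum_mem_critInv q.2), fun r => ?_⟩
  have h := Set.mem_iInter.1 hq r
  rw [Set.mem_ofPred_eq, hT] at h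
  exact h

end EquivSing

end

theorem theorem3p2 {G : Type*} [Group G] [Finite G] {n : ℕ}
    (ρ : Representation ℂ G (Fin n → ℂ)) :
    (∃ f : EquivSing.CritInvGerm ρ, EquivSing.EquivariantlySimple f) ↔
      ∃ f : EquivSing.CritInvGerm ρ, EquivSing.EquivariantlyStable f := by
  constructor
  · rintro ⟨f, N, hf⟩
    have hgen : ∀ᶠ r : ℕ in atTop, ∃ (w : ℕ) (ℓ : Fin w → EquivSing.Jet n r ℂ →ₗ[ℂ] ℂ)
        (D : MvPolynomial (Fin w) ℂ),
        (∃ x : EquivSing.FunJets ρ r, MvPolynomial.eval (fun i => ℓ i x.1) D ≠ 0) ∧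
        ∀ x : EquivSing.FunJets ρ r, MvPolynomial.eval (fun i => ℓ i x.1) D ≠ 0 →
          IsOpen (MulAction.orbit (EquivSing.DiffeoJets ρ r) x) := by
      filter_upwards [hf, eventually_ge_atTop 1] with r hr hr1
      obtain ⟨U, hU, hN⟩ := hr
      obtain ⟨U', hU', hopen, hmem⟩ := mem_nhds_iff.1 hU
      refine EquivSing.exists_generic_isOpen_orbit ρ hr1 hopen ⟨_, hmem⟩ ?_
      refine (Set.finite_of_encard_le_coe hN).subset ?_
      rintro S ⟨hS, hne⟩
      exact ⟨hS, hne.mono (Set.inter_subset_inter_right _ hU')⟩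
    obtain ⟨R, hR⟩ := eventually_atTop.1 hgen
    have hall : ∀ r : ℕ, ∃ (w : ℕ) (ℓ : Fin w → EquivSing.Jet n r ℂ →ₗ[ℂ] ℂ)
        (D : MvPolynomial (Fin w) ℂ),
        (∃ x : EquivSing.FunJets ρ r, MvPolynomial.eval (fun i => ℓ i x.1) D ≠ 0) ∧
        (R ≤ r → ∀ x : EquivSing.FunJets ρ r, MvPolynomial.eval (fun i => ℓ i x.1) D ≠ 0 →
          IsOpen (MulAction.orbit (EquivSing.DiffeoJets ρ r) x)) := by
      intro r
      by_cases hr : R ≤ r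
      · obtain ⟨w, ℓ, D, h1, h2⟩ := hR r hr
        exact ⟨w, ℓ, D, h1, fun _ => h2⟩
      -- Below `R` the condition imposed is vacuous: the constant polynomial `1` in no variables.
      · exact ⟨0, Fin.elim0, 1, ⟨f.jet r, by simp⟩, fun h => absurd h hr⟩
    choose w ℓ D h1 h2 using hall
    obtain ⟨g, hg⟩ := EquivSing.exists_generic_germ ρ ℓ D h1
    exact ⟨g, eventually_atTop.2 ⟨R, fun r hr => h2 r hr _ (hg r)⟩⟩
  · rintro ⟨f, hf⟩
    refine ⟨f, 1, hf.mono fun r hr => ⟨_, hr.mem_nhds (MulAction.mem_orbit_self _), ?_⟩⟩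
    rw [Nat.cast_one, Set.encard_le_one_iff]
    rintro _ _ ⟨⟨j, rfl⟩, x, hxj, hx⟩ ⟨⟨j', rfl⟩, x', hxj', hx'⟩
    rw [← MulAction.orbit_eq_iff.2 hxj, ← MulAction.orbit_eq_iff.2 hxj',
      MulAction.orbit_eq_iff.2 hx, MulAction.orbit_eq_iff.2 hx']
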